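/- **Setting.** A universe of separations is a finite lattice $\vec U$ with an order-reversing involution $\vec s\mapsto \vec s^{\,*}$; write $\overleftarrow{s}=\vec s^{\,*}$, and write $s=\{\vec s,\overleftarrow{s}\}$ for the underlying unoriented separation. It is a submodular universe if it carries a function $|\cdot|\colon\vec U\to\mathbb N_0$ with $|\vec s|=|\overleftarrow{s}|=:|s|$ and $|\vec s|+|\vec t|\ge|\vec s\vee\vec t|+|\vec s\wedge\vec t|$ for all $\vec s,\vec t$. For $k\in\mathbb N_0$ let $\vec S_k=\{\vec s\in\vec U:|\vec s|<k\}$, and let $S_k$ be the corresponding set of unoriented separations. An orientation of $S_k$ is a set $O\subseteq\vec S_k$ containing, for every $s\in S_k$, exactly one element of $\{\vec s,\overleftarrow{s}\}$. A profile of $S_k$ is an orientation $P$ such that there are no $\vec r,\vec s\in P$ with $r\ne s$ and $\overleftarrow{r}\le\vec s$ (consistency), and such that $\overleftarrow{r}\wedge\overleftarrow{s}\notin P$ for all $\vec r,\vec s\in P$. It is regular if it contains no $\vec s$ with $\overleftarrow{s}\le\vec s$. A separation $s$ distinguishes $P$ and $P'$ if it has an orientation $\vec s\in P$ with $\overleftarrow{s}\in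 P'$; it does so efficiently if no $r$ with $|r|<|s|$ distinguishes $P$ and $P'$. A star is a set $\sigma\subseteq\vec S_k$ with $\vec s\le\overleftarrow{t}$ for all distinct $\vec s,\vec t\in\sigma$. For a regular profile $P$ of $S_k$, let $\delta_e(P)$ be the minimum size of a star $\sigma\subseteq P$ such that - there are no $\vec s\in\sigma$ and $\vec s\,'\in P$ with $\vec s\le\vec s\,'$ and $|s'|<|s|$, and - every regular profile $P'\neq P$ of $S_k$ contains $\overleftarrow{s}$ for some $\vec s\in\sigma$. An $S_k$-tree $(T,\alpha)$ is a finite tree $T$ with a map $\alpha$ from its oriented edges to $\vec S_k$ satisfying $\alpha(y,x)=\alpha(x,y)^*$ for every edge $xy$. It is irredundant if $\alpha(x,t)\ne\alpha(y,t)$ for distinct neighbours $x,y$ of any node $t$. It is order-respecting if $\alpha(e)\le\alpha(f)$ whenever the path in $T$ from the tail of $e$ to the head of $f$ contains the head of $e$ and the tail of $f$. An efficient tree of tangles for $S_k$ is an irredundant $S_k$-tree such that any two distinct regular profiles of $S_k$ are efficiently distinguished by some edge label. The node of a regular profile $P$ in $(T,\alpha)$ is the unique node $t$ such that $\alpha(x,t)\in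 P$ for all neighbours $x$ of $t$, and the degree of $P$ in $(T,\alpha)$ is the degree of that node in $T$. **Theorem.** Let $\vec U$ be a submodular universe, let $k\in\mathbb N_0$, and let $\mathcal P$ be the set of all regular profiles of $S_k$. Then there is an order-respecting efficient tree of tangles $(T,\alpha)$ for $S_k$ such that every $P\in\mathcal P$ has a node in $(T,\alpha)$ and has degree exactly $\delta_e(P)$ in $(T,\alpha)$ (in particular, $\delta_e(P)$ is well defined), and such that the maximum degree of $T$ is at most $\max\big(\{\delta_e(P):P\in\mathcal P\}\cup\{3\}\big)$. -/

import Mathlib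

/-- A universe of separations: a lattice together with an order-reversing involution `rev`.
De Morgan's law is a consequence of these axioms. Finiteness is assumed separately. -/
class SeparationUniverse (U : Type*) extends Lattice U where
  rev : U → U
  rev_rev : ∀ s : U, rev (rev s) = s
  rev_le_rev_iff : ∀ s t : U, rev t ≤ rev s ↔ s ≤ t

/-- A universe of separations with a submodular order function. -/
class SubmodularUniverse (U : Type*) extends SeparationUniverse U where
  order : U → ℕ
  order_rev : ∀ s : U, order (rev s) = order s
  order_submodular : ∀ s t : U, order (s ⊔ t) + order (s ⊓ t) ≤ order s + order t

namespace SepSys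

open SeparationUniverse SubmodularUniverse

section Universe

variable {U : Type*} [SeparationUniverse U]

/-- `r` and `s` have the same underlying unoriented separation. -/
def SameSep (r s : U) : Prop := r = s ∨ r = rev s

/-- `s` is cosmall, that is, the inverse of a small separation: `rev s ≤ rev (rev s) = s`. -/
def Cosmall (s : U) : Prop := rev s ≤ s

/-- A set of oriented separations is regular if it contains no cosmall separation. -/
def Regular (O : Set U) : Prop := ∀ s ∈ O, ¬ Cosmall s

/-- `O` is an orientation of the separation system `S`: it contains exactly one of the
orientations of every separation in `S`. -/
def IsOrientation (S O : Set U) : Prop :=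
  O ⊆ S ∧ (∀ s ∈ S, (O ∩ {s, rev s}).encard ≤ 1) ∧ ∀ s ∈ S, s ∈ O ∨ rev s ∈ O

def Consistent (O : Set U) : Prop :=
  ¬ ∃ r ∈ O, ∃ s ∈ O, rev r ≤ s ∧ ¬ SameSep r s

/-- A profile of `S` is a consistent orientation of `S` with the profile property. -/
def IsProfile (S P : Set U) : Prop :=
  IsOrientation S P ∧ Consistent P ∧ ∀ r ∈ P, ∀ s ∈ P, rev r ⊓ rev s ∉ P

def IsRegularProfile (S P : Set U) : Prop := IsProfile S P ∧ Regular P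

/-- A star: distinct elements point towards each other. -/
def IsStar (σ : Set U) : Prop := ∀ s ∈ σ, ∀ t ∈ σ, s ≠ t → s ≤ rev t

def Distinguishes (s : U) (O₁ O₂ : Set U) : Prop :=
  (s ∈ O₁ ∧ rev s ∈ O₂) ∨ (rev s ∈ O₁ ∧ s ∈ O₂)

/-- The natural partial order on the oriented edges of a tree: `e ≤ f` if the path from the tail
of `e` to the head of `f` contains the head of `e` and the tail of `f`. -/
def DartLE {V : Type*} {G : SimpleGraph V} (e f : G.Dart) : Prop :=
  ∃ p : G.Walk e.fst f.snd, p.IsPath ∧ e.snd ∈ p.support ∧ f.fst ∈ p.support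

/-- An `S`-tree: a finite tree whose oriented edges are labelled by elements of `S`, such that
the labelling commutes with reversal. -/
structure STree (S : Set U) where
  V : Type
  finite : Finite V
  graph : SimpleGraph V
  isTree : graph.IsTree
  label : graph.Dart → U
  label_mem : ∀ e, label e ∈ S
  label_symm : ∀ e, label e.symm = rev (label e)

namespace STree

variable {S : Set U}

/-- Distinct oriented edges with the same head have distinct labels. -/
def Irredundant (T : STree S) : Prop :=
  ∀ e f : T.graph.Dart, e.snd = f.snd → e.fst ≠ f.fst → T.label e ≠ T.label f

def OrderRespecting (T : STree S) : Prop :=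
  ∀ e f : T.graph.Dart, DartLE e f → T.label e ≤ T.label f

/-- The number of neighbours of a node. -/
noncomputable def degree (T : STree S) (v : T.V) : ℕ∞ := (T.graph.neighborSet v).encard

/-- A tree of tangles for `S`: an irredundant `S`-tree whose set of edge labels distinguishes any
two regular profiles of `S`. -/
def IsTreeOfTangles (T : STree S) : Prop :=
  T.Irredundant ∧
    ∀ P₁ P₂ : Set U, IsRegularProfile S P₁ → IsRegularProfile S P₂ → P₁ ≠ P₂ →
      ∃ e : T.graph.Dart, Distinguishes (T.label e) P₁ P₂

/-- `v` is a sink of the orientation of the edges induced by `P`: every edge at `v`, oriented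
towards `v`, has its label in `P`. -/
def IsSink (T : STree S) (P : Set U) (v : T.V) : Prop :=
  ∀ e : T.graph.Dart, e.snd = v → T.label e ∈ P

/-- `v` is the node of `P`: the unique sink of the orientation induced by `P`. -/
def IsNodeOf (T : STree S) (P : Set U) (v : T.V) : Prop :=
  T.IsSink P v ∧ ∀ w, T.IsSink P w → w = v

end STree

end Universe

section Submodular

variable {U : Type*} [SubmodularUniverse U]

/-- The separation system of all separations of order less than `k`. -/
def Sk (U : Type*) [SubmodularUniverse U] (k : ℕ) : Set U := {s | order s < k}

def EffDistinguishes (s : U) (O₁ O₂ : Set U) : Prop :=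
  Distinguishes s O₁ O₂ ∧ ¬ ∃ r : U, order r < order s ∧ Distinguishes r O₁ O₂

/-- A tree of tangles is efficient if its edge labels distinguish any two regular profiles
efficiently. -/
def STree.IsEfficientTreeOfTangles {S : Set U} (T : STree S) : Prop :=
  T.IsTreeOfTangles ∧
    ∀ P₁ P₂ : Set U, IsRegularProfile S P₁ → IsRegularProfile S P₂ → P₁ ≠ P₂ →
      ∃ e : T.graph.Dart, EffDistinguishes (T.label e) P₁ P₂

/-- The property `Eff(P)` of a star. -/
def Eff (P σ : Set U) : Prop := ¬ ∃ s ∈ σ, ∃ s' ∈ P, s ≤ s' ∧ order s' < order s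

/-- `σ` is a star in `P` with property `Eff(P)` that distinguishes `P` from all other regular
profiles of `Sk U k`. -/
def IsEffStarFor (k : ℕ) (P σ : Set U) : Prop :=
  σ ⊆ P ∧ IsStar σ ∧ Eff P σ ∧
    ∀ P' : Set U, IsRegularProfile (Sk U k) P' → P' ≠ P → ∃ s ∈ σ, rev s ∈ P'

/-- The minimal size of a star as in `IsEffStarFor`. It is an extended natural number: it would
be `⊤` if there were no such star. -/
noncomputable def deltaE (k : ℕ) (P : Set U) : ℕ∞ :=
  ⨅ (σ : Set U) (_ : IsEffStarFor k P σ), σ.encard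

/-- The maximum of `deltaE k P` over all regular profiles `P` of `Sk U k` (zero if there are
none). -/
noncomputable def deltaEMax (U : Type*) [SubmodularUniverse U] (k : ℕ) : ℕ∞ :=
  ⨆ (P : Set U) (_ : IsRegularProfile (Sk U k) P), deltaE k P

end Submodular

end SepSys

/-! This is a tangle-tree duality argument in which optimal efficient stars are allowed at nodes
beside stars contained in no regular profile (void stars). An up-closed `A ⊆ Sk U k` records a
partial orientation: a profile avoiding `A` contains the inverse of each element of `A`, and
singletons `{a}` with `a ∈ A` serve as provisional leaves. `hasEffTree` yields a tree for every such
`A`, larger sets first; for `A = ∅` no provisional leaves remain.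

If `A` meets every separation, either `A` contains both orientations of some separation, giving a
tree with one edge, or the complement of `A` is an orientation. Such a complement contains a node
star: a failure of the profile axioms produces a void star of at most three elements
(`isRegularProfile_diff`), which is where the 3 in the bound comes from, and a regular profile
contains an optimal efficient star. Attaching leaves from `A` to that star finishes the case.

Otherwise let `t` be an undecided separation of least order, and choose `r₁ ≥ t` and `r₂ ≥ rev t`
maximal outside `A`. The trees for `insert r₁ A` and `insert r₂ A` are shifted until their leaves
`r₁`, `r₂` become the two ends of one edge labelled `t`, and are glued there (a tree not needing its
extra leaf already serves for `A`). Since `t` has least order between `rev r₂` and `r₁`,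
submodularity ensures that shifting raises no order. Profiles that orient `t` differently are
efficiently distinguished by `t`; other pairs keep a shifted distinguisher.

The crux is that shifting respects the node stars (`IsEffStarFor.shift`, `IsNodeStar.shift`): an
efficient star for `P` stays one and does not grow, so it stays optimal. In the final tree the star
at the node of `P` lies in `P`, so it is neither void nor efficient for another profile: it is
optimal for `P`, and the degree is `deltaE k P`. -/

namespace SepSys

open SeparationUniverse SubmodularUniverse

/-! ### Lattice identities in a universe of separations -/

section Lattice

variable {U : Type*} [SeparationUniverse U]

theorem rev_le_iff {s t : U} : rev s ≤ t ↔ rev t ≤ s := by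
  rw [← rev_le_rev_iff (rev s) t, rev_rev]

theorem le_rev_iff {s t : U} : s ≤ rev t ↔ t ≤ rev s := by
  rw [← rev_le_rev_iff s (rev t), rev_rev]

theorem rev_sup (s t : U) : rev (s ⊔ t) = rev s ⊓ rev t := by
  apply le_antisymm
  · exact le_inf ((rev_le_rev_iff _ _).2 le_sup_left) ((rev_le_rev_iff _ _).2 le_sup_right)
  · exact le_rev_iff.1 (sup_le (le_rev_iff.1 inf_le_left) (le_rev_iff.1 inf_le_right))

theorem rev_inf (s t : U) : rev (s ⊓ t) = rev s ⊔ rev t := by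
  conv_lhs => rw [← rev_rev s, ← rev_rev t, ← rev_sup, rev_rev]

theorem rev_injective : Function.Injective (rev : U → U) :=
  Function.LeftInverse.injective (g := rev) rev_rev

theorem Distinguishes.symm {s : U} {O₁ O₂ : Set U} (h : Distinguishes s O₁ O₂) :
    Distinguishes s O₂ O₁ :=
  h.elim (fun h => .inr ⟨h.2, h.1⟩) (fun h => .inl ⟨h.2, h.1⟩)

theorem Distinguishes.rev {s : U} {O₁ O₂ : Set U} (h : Distinguishes s O₁ O₂) :
    Distinguishes (rev s) O₁ O₂ := by
  rcases h with ⟨h₁, h₂⟩ | ⟨h₁, h₂⟩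
  · exact .inr ⟨by rwa [rev_rev], h₂⟩
  · exact .inl ⟨h₁, by rwa [rev_rev]⟩

end Lattice

/-! ### Regular profiles and the existence of efficient stars -/

section Profile

variable {U : Type*} [SubmodularUniverse U] {k : ℕ} {P Q : Set U} {s t : U}

theorem rev_mem_Sk (h : s ∈ Sk U k) : rev s ∈ Sk U k := by
  simpa [Sk, order_rev] using h

namespace IsRegularProfile

theorem subset (h : IsRegularProfile (Sk U k) P) : P ⊆ Sk U k := h.1.1.1

theorem rev_notMem (h : IsRegularProfile (Sk U k) P) (hs : s ∈ P) : rev s ∉ P := by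
  intro hs'
  have h1 := h.1.1.2.1 s (h.subset hs)
  have h2 : s = rev s := Set.encard_le_one_iff.1 h1 s (rev s) ⟨hs, by simp⟩ ⟨hs', by simp⟩
  exact h.2 s hs h2.symm.le

theorem rev_mem (h : IsRegularProfile (Sk U k) P) (hs : s ∈ Sk U k) (hs' : s ∉ P) :
    rev s ∈ P := (h.1.1.2.2 s hs).resolve_left hs'

theorem mem_of_rev_notMem (h : IsRegularProfile (Sk U k) P) (hs : s ∈ Sk U k)
    (hs' : rev s ∉ P) : s ∈ P := (h.1.1.2.2 s hs).resolve_right hs'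

theorem mem_of_le (h : IsRegularProfile (Sk U k) P) (hs : s ∈ P) (ht : t ∈ Sk U k)
    (hts : t ≤ s) : t ∈ P := by
  by_contra h0
  have h1 := h.rev_mem ht h0
  refine h.1.2.1 ⟨rev t, h1, s, hs, by rwa [rev_rev], ?_⟩
  rintro (h2 | h2)
  · exact h.2 s hs (by rw [← h2, Cosmall, rev_rev, h2]; exact hts)
  · exact h0 (rev_injective h2 ▸ hs)

theorem sup_mem (h : IsRegularProfile (Sk U k) P) (hs : s ∈ P) (ht : t ∈ P)
    (hst : s ⊔ t ∈ Sk U k) : s ⊔ t ∈ P := by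
  by_contra h0
  exact h.1.2.2 s hs t ht (rev_sup s t ▸ h.rev_mem hst h0)

theorem exists_of_ne (hP : IsRegularProfile (Sk U k) P) (hQ : IsRegularProfile (Sk U k) Q)
    (hPQ : Q ≠ P) : ∃ s ∈ P, rev s ∈ Q := by
  by_contra! h0
  apply hPQ
  ext s
  constructor
  · intro hs
    refine hP.mem_of_rev_notMem (hQ.subset hs) fun h => h0 _ h ?_
    rwa [rev_rev]
  · exact fun hs => hQ.mem_of_rev_notMem (hP.subset hs) (h0 s hs)

end IsRegularProfile

theorem EffDistinguishes.symm (h : EffDistinguishes s P Q) : EffDistinguishes s Q P :=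
  ⟨h.1.symm, fun ⟨r, h1, h2⟩ => h.2 ⟨r, h1, h2.symm⟩⟩

theorem EffDistinguishes.rev (h : EffDistinguishes s P Q) : EffDistinguishes (rev s) P Q :=
  ⟨h.1.rev, by simpa only [order_rev] using h.2⟩

theorem order_inf_rev_le_or (s t : U) :
    order (s ⊓ rev t) ≤ order s ∨ order (t ⊓ rev s) ≤ order t := by
  have h1 := order_submodular s (rev t)
  have h2 : order (s ⊔ rev t) = order (t ⊓ rev s) := by
    rw [← order_rev, rev_sup, rev_rev, inf_comm]
  rw [order_rev] at h1
  omega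

/-- A weight that orders separations first by their order and then by the size of their
down-closure. -/
noncomputable def starWeight (s : U) : ℕ := order s * (Nat.card U + 1) + (Set.Iic s).ncard

theorem starWeight_lt_of_order_lt [Finite U] (h : order s < order t) :
    starWeight s < starWeight t := by
  have h1 : (Set.Iic s).ncard ≤ Nat.card U := Set.ncard_le_card _
  have h2 : (order s + 1) * (Nat.card U + 1) ≤ order t * (Nat.card U + 1) :=
    Nat.mul_le_mul_right _ h
  unfold starWeight
  rw [add_mul] at h2
  omega

theorem starWeight_lt_of_lt [Finite U] (h : order s ≤ order t) (hst : s < t) :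
    starWeight s < starWeight t := by
  have h1 : (Set.Iic s).ncard < (Set.Iic t).ncard :=
    Set.ncard_lt_ncard (Set.Iic_ssubset_Iic.2 hst)
  have h2 := Nat.mul_le_mul_right (Nat.card U + 1) h
  unfold starWeight
  omega

/-- Among the subsets of `P` that distinguish it from all other regular profiles, take one of least
total weight: no element can be exchanged for a lighter one. Crossing elements could be uncrossed to
a smaller separation of no larger order, and a violation of `Eff` could be exchanged for its
witness. -/
theorem exists_isEffStarFor [Finite U] (hP : IsRegularProfile (Sk U k) P) :
    ∃ σ : Set U, IsEffStarFor k P σ := by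
  classical
  have := Fintype.ofFinite U
  let C : Set (Finset U) := {σ | (σ : Set U) ⊆ P ∧
    ∀ P', IsRegularProfile (Sk U k) P' → P' ≠ P → ∃ s ∈ σ, rev s ∈ P'}
  have hC : P.toFinset ∈ C := ⟨by simp, fun P' h1 h2 => by
    simpa using hP.exists_of_ne h1 h2⟩
  obtain ⟨σ, hσ, hmin⟩ := (Set.toFinite C).exists_minimalFor
    (fun σ => ∑ s ∈ σ, starWeight s) C ⟨_, hC⟩
  have hrep : ∀ s ∈ σ, ∀ s' ∈ P, starWeight s' < starWeight s →
      ¬ insert s' (σ.erase s) ∈ C := by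
    intro s hs s' _ hw h
    have h1 : ∑ x ∈ insert s' (σ.erase s), starWeight x ≤
        starWeight s' + ∑ x ∈ σ.erase s, starWeight x := by
      by_cases h : s' ∈ σ.erase s
      · rw [Finset.insert_eq_of_mem h]; omega
      · rw [Finset.sum_insert h]
    have h2 := Finset.add_sum_erase σ (starWeight (U := U)) hs
    have h3 := hmin h (by simp only; omega)
    simp only at h3
    omega
  refine ⟨σ, hσ.1, ?_, ?_, fun P' h1 h2 => by simpa using hσ.2 P' h1 h2⟩
  · have key : ∀ s ∈ σ, ∀ t ∈ σ, s ≠ t → order (s ⊓ rev t) ≤ order s → s ≤ rev t := by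
      intro s hs t ht hst ho
      by_contra h0
      have hlt : s ⊓ rev t < s := inf_lt_left.2 h0
      have hmem : s ⊓ rev t ∈ P :=
        hP.mem_of_le (hσ.1 hs) (lt_of_le_of_lt ho (hP.subset (hσ.1 hs))) inf_le_left
      refine hrep s hs _ hmem (starWeight_lt_of_lt ho hlt) ⟨?_, ?_⟩
      · intro x hx
        simp only [Finset.coe_insert, Set.mem_insert_iff, Finset.mem_coe, Finset.mem_erase] at hx
        rcases hx with rfl | hx
        exacts [hmem, hσ.1 hx.2]
      · intro P' h1 h2
        obtain ⟨x, hx, hx'⟩ := hσ.2 P' h1 h2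
        by_cases hxs : x = s
        · subst hxs
          -- Either `t` itself distinguishes `P'`, or `P'` contains `t` and hence the join `rev x ⊔
          -- t`.
          by_cases htP : t ∈ P'
          · refine ⟨x ⊓ rev t, by simp, ?_⟩
            have h3 : rev (x ⊓ rev t) = rev x ⊔ t := by rw [rev_inf, rev_rev]
            rw [h3]
            refine h1.sup_mem hx' htP ?_
            rw [← h3]
            exact rev_mem_Sk (hP.subset hmem)
          · exact ⟨t, by simp [ht, hst.symm], h1.rev_mem (hP.subset (hσ.1 ht)) htP⟩
        · exact ⟨x, by simp [hx, hxs], hx'⟩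
    intro s hs t ht hst
    rcases order_inf_rev_le_or s t with h | h
    · exact key s hs t ht hst h
    · exact le_rev_iff.1 (key t ht s hs hst.symm h)
  · rintro ⟨s, hs, s', hs', hle, hlt⟩
    refine hrep s hs s' hs' (starWeight_lt_of_order_lt hlt) ⟨?_, ?_⟩
    · intro x hx
      simp only [Finset.coe_insert, Set.mem_insert_iff, Finset.mem_coe, Finset.mem_erase] at hx
      rcases hx with rfl | hx
      exacts [hs', hσ.1 hx.2]
    · intro P' h1 h2
      obtain ⟨x, hx, hx'⟩ := hσ.2 P' h1 h2
      by_cases hxs : x = s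
      · subst hxs
        exact ⟨s', by simp, h1.mem_of_le hx' (rev_mem_Sk (hP.subset hs'))
          ((rev_le_rev_iff _ _).2 hle)⟩
      · exact ⟨x, by simp [hx, hxs], hx'⟩

theorem exists_isEffStarFor_encard_eq [Finite U] (hP : IsRegularProfile (Sk U k) P) :
    ∃ σ : Set U, IsEffStarFor k P σ ∧ σ.encard = deltaE k P := by
  obtain ⟨σ, hσ, hmin⟩ := (Set.toFinite {σ : Set U | IsEffStarFor k P σ}).exists_minimalFor
    Set.encard _ (exists_isEffStarFor hP)
  refine ⟨σ, hσ, le_antisymm (le_iInf₂ fun τ hτ => ?_) (iInf₂_le σ hσ)⟩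
  exact (le_total σ.encard τ.encard).elim id (hmin hτ)

end Profile

/-! ### Inductive trees over a family of stars, rerooting and star shifts -/

section Branch

variable {U : Type*} [SeparationUniverse U]

/-- `Branch F s E`: there is a finite tree with a distinguished leaf whose edge, pointing away from
that leaf, is labelled `s`, whose other nodes carry stars in `F`, and whose edge labels, pointing
away from that leaf, form the set `E`. -/
inductive Branch (F : Set (Set U)) : U → Set U → Prop
  | mk (σ : Set U) (s : U) (E : U → Set U) (hσ : σ ∈ F) (hs : s ∈ σ)
      (h : ∀ t ∈ σ, t ≠ s → Branch F (rev t) (E t)) :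
      Branch F s (insert s (⋃ t ∈ σ \ {s}, E t))

/-- `TreeOver F E`: there is a finite tree whose nodes carry stars in `F` and whose edge labels,
up to inversion, form the set `E`. -/
def TreeOver (F : Set (Set U)) (E : Set U) : Prop :=
  ∃ σ ∈ F, ∃ D : U → Set U, (∀ t ∈ σ, Branch F (rev t) (D t)) ∧ E = ⋃ t ∈ σ, D t

variable {F F' : Set (Set U)} {s r : U} {E D : Set U}

theorem Branch.self_mem (h : Branch F s E) : s ∈ E := by
  cases h; simp

theorem Branch.le (hF : ∀ σ ∈ F, IsStar σ) (h : Branch F s E) : ∀ e ∈ E, s ≤ e := by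
  induction h with
  | mk σ s E hσ hs h ih =>
    intro e he
    simp only [Set.mem_insert_iff, Set.mem_iUnion, Set.mem_sdiff, Set.mem_singleton_iff] at he
    rcases he with rfl | ⟨t, ⟨ht, hts⟩, he⟩
    · exact le_rfl
    · exact (hF σ hσ s hs t ht (Ne.symm hts)).trans (ih t ht hts e he)

theorem Branch.mono (hF : F ⊆ F') (h : Branch F s E) : Branch F' s E := by
  induction h with
  | mk σ s E hσ hs h ih => exact .mk σ s E (hF hσ) hs ih

theorem Branch.leaf (h : {s} ∈ F) : Branch F s {s} := by
  have := Branch.mk (F := F) {s} s (fun _ => ∅) h rfl (fun t ht hts => absurd ht hts)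
  simpa using this

theorem TreeOver.mono (hF : F ⊆ F') (h : TreeOver F E) : TreeOver F' E := by
  obtain ⟨σ, hσ, D, hD, rfl⟩ := h
  exact ⟨σ, hF hσ, D, fun t ht => (hD t ht).mono hF, rfl⟩

theorem Branch.glue (h : Branch F s E) (h' : Branch F (rev s) D) :
    ∃ E', TreeOver F E' ∧ ∀ e ∈ E ∪ D, e ∈ E' ∨ rev e ∈ E' := by
  classical
  have hs' := h'.self_mem
  cases h with
  | mk σ _ E hσ hs h =>
    refine ⟨_, ⟨σ, hσ, fun t => if t = s then D else E t, ?_, rfl⟩, ?_⟩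
    · intro t ht
      by_cases hts : t = s
      · subst hts; simpa using h'
      · simpa [hts] using h t ht hts
    · have hD : ∀ e ∈ D, e ∈ ⋃ t ∈ σ, if t = s then D else E t := fun e he =>
        Set.mem_biUnion hs (by simpa using he)
      rintro e ((rfl | he) | he)
      · exact .inr (hD _ hs')
      · obtain ⟨t, ht, he⟩ := Set.mem_iUnion₂.1 he
        exact .inl (Set.mem_biUnion ht.1 (by simpa [show t ≠ s from ht.2] using he))
      · exact .inl (hD _ he)

/-- If the branch cannot be built over `F` alone, a leaf `{r}` is found by descending into children
that fail in the same way. On the way down, everything left behind, including the branch `D`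
attached at the root, is collected on the far side of the current edge. -/
theorem Branch.reroot (h : Branch (insert {r} F) s E) :
    Branch F s E ∨ ∀ D, Branch (insert {r} F) (rev s) D →
      ∃ E', Branch (insert {r} F) (rev r) E' ∧ ∀ e ∈ E ∪ D, e ∈ E' ∨ rev e ∈ E' := by
  classical
  induction h with
  | mk σ s E hσ hs h ih =>
    by_cases hall : ∀ t ∈ σ, t ≠ s → Branch F (rev t) (E t)
    · rcases hσ with rfl | hσ
      · right
        intro D hD
        obtain rfl : s = r := hs
        refine ⟨D, hD, ?_⟩
        rintro e ((rfl | he) | he)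
        · exact .inr hD.self_mem
        · simp at he
        · exact .inl he
      · exact .inl (.mk σ s E hσ hs hall)
    · right
      intro D hD
      push Not at hall
      obtain ⟨t, ht, hts, hn⟩ := hall
      have ih' := (ih t ht hts).resolve_left hn
      have hb := Branch.mk (F := insert {r} F) σ t (fun x => if x = s then D else E x) hσ ht
        (fun x hx hxt => by
          by_cases hxs : x = s
          · subst hxs; simpa using hD
          · simpa [hxs] using h x hx hxs)
      obtain ⟨E', hE', hcov⟩ := ih' _ (by rwa [rev_rev])
      have hD' : ∀ e ∈ D, e ∈ E' ∨ rev e ∈ E' := fun e he => hcov e <| .inr <| .inr <|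
        Set.mem_biUnion (x := s) ⟨hs, Ne.symm hts⟩ (by simpa using he)
      refine ⟨E', hE', ?_⟩
      rintro e ((rfl | he) | he)
      · simpa [rev_rev, or_comm] using hD' _ hD.self_mem
      · obtain ⟨x, hx, he⟩ := Set.mem_iUnion₂.1 he
        by_cases hxt : x = t
        · subst hxt; exact hcov e (.inl he)
        · exact hcov e <| .inr <| .inr <| Set.mem_biUnion (x := x) ⟨hx.1, hxt⟩
            (by simpa [show x ≠ s from hx.2] using he)
      · exact hD' e he

theorem TreeOver.reroot (h : TreeOver (insert {r} F) E) :
    TreeOver F E ∨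
      ∃ E', Branch (insert {r} F) (rev r) E' ∧ ∀ e ∈ E, e ∈ E' ∨ rev e ∈ E' := by
  obtain ⟨σ, hσ, D, hD, rfl⟩ := h
  by_cases hall : ∀ t ∈ σ, Branch F (rev t) (D t)
  · rcases hσ with rfl | hσ
    · refine .inr ⟨D r, hD r rfl, fun e he => .inl ?_⟩
      simpa using he
    · exact .inl ⟨σ, hσ, D, hall, rfl⟩
  · right
    push Not at hall
    obtain ⟨t, ht, hn⟩ := hall
    have hb := Branch.mk σ t D hσ ht (fun x hx _ => hD x hx)
    obtain ⟨E', hE', hcov⟩ := (hD t ht).reroot.resolve_left hn _ (by rwa [rev_rev])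
    refine ⟨E', hE', fun e he => ?_⟩
    obtain ⟨x, hx, he⟩ := Set.mem_iUnion₂.1 he
    by_cases hxt : x = t
    · subst hxt; exact hcov e (.inl he)
    · exact hcov e <| .inr <| .inr <| Set.mem_biUnion (x := x) ⟨hx, hxt⟩ he

/-- Follow the edges in the direction in which `P` orients them; the walk into the tree must stop,
and it stops at a star contained in `P`. -/
theorem Branch.exists_subset {P : Set U} (hF : ∀ σ ∈ F, ∀ t ∈ σ, t ∈ P ∨ rev t ∈ P)
    (h : Branch F s E) (hs : s ∈ P) : ∃ σ ∈ F, σ ⊆ P := by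
  induction h with
  | mk σ s E hσ _ h ih =>
    by_cases hall : σ ⊆ P
    · exact ⟨σ, hσ, hall⟩
    · obtain ⟨t, ht, htP⟩ := Set.not_subset.1 hall
      exact ih t ht (fun h => htP (h ▸ hs)) ((hF σ hσ t ht).resolve_left htP)

theorem TreeOver.exists_subset {P : Set U} (hF : ∀ σ ∈ F, ∀ t ∈ σ, t ∈ P ∨ rev t ∈ P)
    (h : TreeOver F E) : ∃ σ ∈ F, σ ⊆ P := by
  obtain ⟨σ, hσ, D, hD, rfl⟩ := h
  by_cases hall : σ ⊆ P
  · exact ⟨σ, hσ, hall⟩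
  · obtain ⟨t, ht, htP⟩ := Set.not_subset.1 hall
    exact (hD t ht).exists_subset hF ((hF σ hσ t ht).resolve_left htP)

/-- The image of the star `σ` under shifting its element `s` to `s ⊔ p`. -/
def shiftStar (σ : Set U) (s p : U) : Set U :=
  insert (s ⊔ p) ((fun b => b ⊓ rev p) '' (σ \ {s}))

theorem IsStar.shift {σ : Set U} (hσ : IsStar σ) {s : U} (hs : s ∈ σ) (p : U) :
    IsStar (shiftStar σ s p) := by
  have key : ∀ b ∈ σ \ {s}, b ⊓ rev p ≤ rev (s ⊔ p) := fun b hb => by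
    rw [rev_sup]; exact inf_le_inf_right _ (hσ b hb.1 s hs hb.2)
  rintro _ (rfl | ⟨b, hb, rfl⟩) _ (rfl | ⟨c, hc, rfl⟩) hne
  · exact absurd rfl hne
  · exact le_rev_iff.1 (key c hc)
  · exact key b hb
  · have hbc : b ≠ c := fun h => hne (by rw [h])
    exact inf_le_left.trans ((hσ b hb.1 c hc.1 hbc).trans
      ((rev_le_rev_iff _ _).2 inf_le_left))

theorem encard_shiftStar_le {σ : Set U} {s : U} (hs : s ∈ σ) (p : U) :
    (shiftStar σ s p).encard ≤ σ.encard := by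
  have h1 := Set.encard_insert_le ((fun b => b ⊓ rev p) '' (σ \ {s})) (s ⊔ p)
  refine h1.trans ?_
  rw [← Set.encard_sdiff_singleton_add_one hs]
  exact add_le_add_left (Set.encard_image_le _ _) 1

end Branch

/-! ### Shifting trees and node stars along submodularity -/

section Shift

variable {U : Type*} [SubmodularUniverse U] {k : ℕ} {F F' : Set (Set U)} {q p r s : U}
  {σ E A : Set U} {P Q : Set U}

/-- The meet `a ⊓ p` lies between `q` and `p`, so its order is at least that of `p`; submodularity
passes the gain to the join. -/
theorem order_sup_le_of_le (hqp : q ≤ p) (hp : ∀ x, q ≤ x → x ≤ p → order p ≤ order x)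
    {a : U} (ha : q ≤ a) : order (a ⊔ p) ≤ order a := by
  have h1 := order_submodular a p
  have h2 := hp (a ⊓ p) (le_inf ha hqp) inf_le_right
  omega

theorem order_inf_rev_le_of_le (hqp : q ≤ p) (hp : ∀ x, q ≤ x → x ≤ p → order p ≤ order x)
    {b : U} (hb : q ≤ rev b) : order (b ⊓ rev p) ≤ order b := by
  have := order_sup_le_of_le hqp hp hb
  rwa [← order_rev (b ⊓ rev p), rev_inf, rev_rev, ← order_rev b]

/-- Each node star is shifted, so each label `e` should become `e ⊔ p`. Distinct children may
acquire the same label, and only one of their subtrees can be kept. At most one of them matters to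
regular profiles containing `p`, so no label needed later is lost. -/
theorem Branch.shift (hstar : ∀ σ ∈ F, IsStar σ) (hsub : ∀ σ ∈ F, σ ⊆ Sk U k)
    (hqp : q ≤ p) (hp : ∀ x, q ≤ x → x ≤ p → order p ≤ order x)
    (hF : ∀ σ ∈ F, ∀ s ∈ σ, q ≤ s → shiftStar σ s p ∈ F')
    (h : Branch F s E) (hqs : q ≤ s) :
    ∃ E', Branch F' (s ⊔ p) E' ∧
      ∀ e ∈ E, ∀ Q, IsRegularProfile (Sk U k) Q → p ∈ Q → e ∈ Q → e ⊔ p ∈ E' := by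
  induction h with
  | mk σ s E hσ hs h ih =>
    have hsle : ∀ t ∈ σ, t ≠ s → s ≤ rev t := fun t ht hts => hstar σ hσ s hs t ht (Ne.symm hts)
    have ih' : ∀ t, ∃ E', t ∈ σ → t ≠ s → Branch F' (rev t ⊔ p) E' ∧
        ∀ e ∈ E t, ∀ Q, IsRegularProfile (Sk U k) Q → p ∈ Q → e ∈ Q → e ⊔ p ∈ E' := by
      intro t
      by_cases ht : t ∈ σ ∧ t ≠ s
      · obtain ⟨E', hE'⟩ := ih t ht.1 ht.2 (hqs.trans (hsle t ht.1 ht.2))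
        exact ⟨E', fun _ _ => hE'⟩
      · exact ⟨∅, fun h1 h2 => absurd ⟨h1, h2⟩ ht⟩
    choose D hD using ih'
    -- among the preimages of `u`, prefer one behind which some relevant profile lives
    let Rel : U → Prop := fun c => ∃ Q, IsRegularProfile (Sk U k) Q ∧ p ∈ Q ∧ rev c ∈ Q
    have hc : ∀ u, ∃ c, u ∈ shiftStar σ s p → u ≠ s ⊔ p → c ∈ σ ∧ c ≠ s ∧ c ⊓ rev p = u ∧
        ((∃ c', c' ∈ σ ∧ c' ≠ s ∧ c' ⊓ rev p = u ∧ Rel c') → Rel c) := by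
      intro u
      by_cases h1 : ∃ c', c' ∈ σ ∧ c' ≠ s ∧ c' ⊓ rev p = u ∧ Rel c'
      · obtain ⟨c', h2, h3, h4, h5⟩ := h1
        exact ⟨c', fun _ _ => ⟨h2, h3, h4, fun _ => h5⟩⟩
      · by_cases h2 : u ∈ shiftStar σ s p ∧ u ≠ s ⊔ p
        · obtain ⟨c, hc, hcu⟩ := h2.1.resolve_left h2.2
          exact ⟨c, fun _ _ => ⟨hc.1, hc.2, hcu, fun h => absurd h h1⟩⟩
        · exact ⟨u, fun h3 h4 => absurd ⟨h3, h4⟩ h2⟩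
    choose c hc using hc
    refine ⟨_, .mk (shiftStar σ s p) (s ⊔ p) (fun u => D (c u)) (hF σ hσ s hs hqs)
      (Set.mem_insert _ _) ?_, ?_⟩
    · intro u hu hus
      obtain ⟨h1, h2, h3, -⟩ := hc u hu hus
      have := (hD (c u) h1 h2).1
      rwa [← h3, rev_inf, rev_rev, h3]
    · intro e he Q hQ hpQ heQ
      rcases he with rfl | he
      · exact Set.mem_insert _ _
      right
      obtain ⟨t, ⟨ht, hts⟩, he⟩ := Set.mem_iUnion₂.1 he
      have hts : t ≠ s := hts
      have hpk := hQ.subset hpQ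
      have hSk : ∀ x ∈ σ, x ≠ s → rev x ⊔ p ∈ Sk U k := fun x hx hxs =>
        lt_of_le_of_lt (order_sup_le_of_le hqp hp (hqs.trans (hsle x hx hxs)))
          (rev_mem_Sk (hsub σ hσ hx))
      have htQ : rev t ∈ Q :=
        hQ.mem_of_le heQ (rev_mem_Sk (hsub σ hσ ht)) ((h t ht hts).le hstar e he)
      have hrev : rev (t ⊓ rev p) = rev t ⊔ p := by rw [rev_inf, rev_rev]
      have huQ : rev (t ⊓ rev p) ∈ Q := hrev ▸ hQ.sup_mem htQ hpQ (hSk t ht hts)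
      have hus : t ⊓ rev p ≠ s ⊔ p := by
        intro heq
        have hsQ : s ∈ Q := hQ.mem_of_le htQ (hsub σ hσ hs) (hsle t ht hts)
        have hspQ : s ⊔ p ∈ Q := hQ.sup_mem hsQ hpQ
          (lt_of_le_of_lt (order_sup_le_of_le hqp hp hqs) (hsub σ hσ hs))
        exact hQ.rev_notMem hspQ (heq ▸ huQ)
      have hu : t ⊓ rev p ∈ shiftStar σ s p := .inr ⟨t, ⟨ht, hts⟩, rfl⟩
      obtain ⟨h1, h2, h3, h4⟩ := hc _ hu hus
      obtain ⟨Q', hQ', hpQ', hcQ'⟩ := h4 ⟨t, ht, hts, rfl, Q, hQ, hpQ, htQ⟩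
      -- If another child were kept, its witnessing profile `Q'` would contain `rev t ⊔ p`, hence
      -- `rev t`, hence the kept child itself by the star property, as well as that child's inverse.
      have hct : c (t ⊓ rev p) = t := by
        by_contra hne
        have h5 : rev t ⊔ p = rev (c (t ⊓ rev p)) ⊔ p := by
          have := congrArg rev h3
          rw [rev_inf, rev_rev, hrev] at this
          exact this.symm
        have h6 : rev t ⊔ p ∈ Q' := h5 ▸ hQ'.sup_mem hcQ' hpQ' (hSk _ h1 h2)
        have h7 : rev t ∈ Q' := hQ'.mem_of_le h6 (rev_mem_Sk (hsub σ hσ ht)) le_sup_left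
        exact hQ'.rev_notMem (hQ'.mem_of_le h7 (hsub σ hσ h1) (hstar σ hσ _ h1 t ht hne)) hcQ'
      exact Set.mem_biUnion (x := t ⊓ rev p) ⟨hu, hus⟩
        (by rw [hct]; exact (hD t ht hts).2 e he Q hQ hpQ heQ)

/-- The stars used at the nodes of the trees: stars contained in no regular profile and of bounded
size, optimal efficient stars of the regular profiles that avoid `B`, and singletons in `A`. -/
inductive IsNodeStar (k : ℕ) (B A : Set U) : Set U → Prop
  | void (σ : Set U) (hS : σ ⊆ Sk U k) (hσ : IsStar σ)
      (hv : ∀ P, IsRegularProfile (Sk U k) P → ¬ σ ⊆ P)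
      (hc : σ.encard ≤ max (deltaEMax U k) 3) : IsNodeStar k B A σ
  | eff (P σ : Set U) (hP : IsRegularProfile (Sk U k) P) (hB : ∀ b ∈ B, b ∉ P)
      (hσ : IsEffStarFor k P σ) (hc : σ.encard = deltaE k P) : IsNodeStar k B A σ
  | leaf (a : U) (hS : a ∈ Sk U k) (ha : a ∈ A) : IsNodeStar k B A {a}

variable {B B' A' : Set U}

theorem isStar_singleton (s : U) : IsStar ({s} : Set U) := by
  rintro _ rfl _ rfl h
  exact absurd rfl h

theorem IsNodeStar.isStar (h : IsNodeStar k B A σ) : IsStar σ := by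
  cases h with
  | void _ _ h => exact h
  | eff _ _ _ _ h => exact h.2.1
  | leaf a => exact isStar_singleton a

theorem IsNodeStar.subset (h : IsNodeStar k B A σ) : σ ⊆ Sk U k := by
  cases h with
  | void _ h => exact h
  | eff _ _ hP _ h => exact h.1.trans hP.subset
  | leaf a ha => simpa using ha

theorem IsNodeStar.mono (hB : B' ⊆ B) (hA : A ⊆ A') (h : IsNodeStar k B A σ) :
    IsNodeStar k B' A' σ := by
  cases h with
  | void _ h1 h2 h3 h4 => exact .void _ h1 h2 h3 h4
  | eff P _ h1 h2 h3 h4 => exact .eff P _ h1 (fun b hb => h2 b (hB hb)) h3 h4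
  | leaf a h1 h2 => exact .leaf a h1 (hA h2)

theorem deltaE_le_deltaEMax (hP : IsRegularProfile (Sk U k) P) :
    deltaE k P ≤ deltaEMax U k :=
  le_iSup₂ (f := fun (P : Set U) (_ : IsRegularProfile (Sk U k) P) => deltaE k P) P hP

theorem isNodeStar_singleton_of_cosmall (hs : s ∈ Sk U k) (h : Cosmall s) :
    IsNodeStar k B A {s} := by
  refine .void _ (by simpa using hs) (isStar_singleton s) ?_ ?_
  · exact fun P hP hsP => hP.2 s (hsP rfl) h
  · rw [Set.encard_singleton]
    exact le_max_of_le_right (by norm_num)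

theorem shiftStar_subset_Sk (hqp : q ≤ p) (hp : ∀ x, q ≤ x → x ≤ p → order p ≤ order x)
    (hσ : IsStar σ) (hS : σ ⊆ Sk U k) (hs : s ∈ σ) (hqs : q ≤ s) :
    shiftStar σ s p ⊆ Sk U k := by
  rintro _ (rfl | ⟨b, ⟨hb, hbs⟩, rfl⟩)
  · exact lt_of_le_of_lt (order_sup_le_of_le hqp hp hqs) (hS hs)
  · exact lt_of_le_of_lt
      (order_inf_rev_le_of_le hqp hp (hqs.trans (hσ s hs b hb (Ne.symm hbs)))) (hS hb)

theorem mem_and_subset_of_shiftStar_subset (hpk : p ∈ Sk U k) (hS : σ ⊆ Sk U k) (hs : s ∈ σ)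
    (hQ : IsRegularProfile (Sk U k) Q) (h : shiftStar σ s p ⊆ Q) : p ∈ Q ∧ σ ⊆ Q := by
  have h1 : s ⊔ p ∈ Q := h (Set.mem_insert _ _)
  have hpQ : p ∈ Q := hQ.mem_of_le h1 hpk le_sup_right
  refine ⟨hpQ, fun b hb => ?_⟩
  by_cases hbs : b = s
  · subst hbs
    exact hQ.mem_of_le h1 (hS hs) le_sup_left
  · have h2 : b ⊓ rev p ∈ Q := h (.inr ⟨b, ⟨hb, hbs⟩, rfl⟩)
    by_contra h0
    have h3 : rev (b ⊓ rev p) = rev b ⊔ p := by rw [rev_inf, rev_rev]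
    refine hQ.rev_notMem h2 ?_
    rw [h3]
    refine hQ.sup_mem (hQ.rev_mem (hS hb) h0) hpQ ?_
    rw [← h3]
    exact rev_mem_Sk (hQ.subset h2)

/-- The delicate point is `Eff` at `b ⊓ rev p`. A violating `s'` can be replaced by `b ⊓ s'`: by
`Eff` at `b`, the join `b ⊔ s'` has order at least that of `b`. Submodularity of `b ⊓ s'` with `rev
p`, together with the minimality of `p` above `q`, then contradicts the violation. -/
theorem IsEffStarFor.shift (hP : IsRegularProfile (Sk U k) P) (hpP : p ∈ P)
    (hqp : q ≤ p) (hp : ∀ x, q ≤ x → x ≤ p → order p ≤ order x)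
    (hσ : IsEffStarFor k P σ) (hs : s ∈ σ) (hqs : q ≤ s) :
    IsEffStarFor k P (shiftStar σ s p) := by
  obtain ⟨hσP, hstar, heff, hdist⟩ := hσ
  have hS := shiftStar_subset_Sk hqp hp hstar (hσP.trans hP.subset) hs hqs
  have hsub : shiftStar σ s p ⊆ P := by
    rintro x hx
    have hxS := hS hx
    rcases hx with rfl | ⟨b, ⟨hb, hbs⟩, rfl⟩
    · exact hP.sup_mem (hσP hs) hpP hxS
    · exact hP.mem_of_le (hσP hb) hxS inf_le_left
  refine ⟨hsub, hstar.shift hs p, ?_, ?_⟩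
  · rintro ⟨_, (rfl | ⟨b, ⟨hb, hbs⟩, rfl⟩), s', hs', hle, hlt⟩
    · exact heff ⟨s, hs, s', hs', le_sup_left.trans hle,
        hlt.trans_le (order_sup_le_of_le hqp hp hqs)⟩
    · dsimp only at hle hlt
      have hqb : q ≤ rev b := hqs.trans (hstar s hs b hb (Ne.symm hbs))
      have hob := order_inf_rev_le_of_le hqp hp hqb
      have hbk := hP.subset (hσP hb)
      have h1 : order b ≤ order (b ⊔ s') := by
        by_contra! h0
        exact heff ⟨b, hb, b ⊔ s', hP.sup_mem (hσP hb) hs' (h0.trans hbk), le_sup_left, h0⟩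
      have h2 := order_submodular b s'
      have h3 : b ⊓ rev p ≤ b ⊓ s' := le_inf inf_le_left hle
      have h4 : (b ⊓ s') ⊓ rev p = b ⊓ rev p :=
        le_antisymm (inf_le_inf_right _ inf_le_left) (le_inf h3 inf_le_right)
      have h5 := order_submodular (b ⊓ s') (rev p)
      rw [h4, order_rev p, ← order_rev (_ ⊔ _), rev_sup, rev_rev] at h5
      have h6 : q ≤ rev (b ⊓ s') := hqb.trans ((rev_le_rev_iff _ _).2 inf_le_left)
      have h7 := hp _ (le_inf h6 hqp) inf_le_right
      omega
  · intro Q hQ hQP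
    by_cases hpQ : p ∈ Q
    · obtain ⟨x, hx, hxQ⟩ := hdist Q hQ hQP
      by_cases hxs : x = s
      · subst hxs
        have hmem : x ⊔ p ∈ shiftStar σ x p := Set.mem_insert _ _
        exact ⟨_, hmem, hQ.mem_of_le hxQ (rev_mem_Sk (hS hmem))
          ((rev_le_rev_iff _ _).2 le_sup_left)⟩
      · have hmem : x ⊓ rev p ∈ shiftStar σ s p := .inr ⟨x, ⟨hx, hxs⟩, rfl⟩
        have h3 : rev (x ⊓ rev p) = rev x ⊔ p := by rw [rev_inf, rev_rev]
        have h4 := rev_mem_Sk (hS hmem)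
        refine ⟨_, hmem, ?_⟩
        rw [h3] at h4 ⊢
        exact hQ.sup_mem hxQ hpQ h4
    · have hmem : s ⊔ p ∈ shiftStar σ s p := Set.mem_insert _ _
      exact ⟨_, hmem, hQ.mem_of_le (hQ.rev_mem (hP.subset hpP) hpQ) (rev_mem_Sk (hS hmem))
        ((rev_le_rev_iff _ _).2 le_sup_right)⟩

/-- An efficient star for `P` stays efficient if `p ∈ P`. Otherwise the shifted star becomes void,
because a profile containing it would contain `p` and the whole original star. -/
theorem IsNodeStar.shift (hpk : p ∈ Sk U k) (hrp : rev r ≤ p)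
    (hp : ∀ x, rev r ≤ x → x ≤ p → order p ≤ order x)
    (hA : ∀ a ∈ A, ∀ b ∈ Sk U k, a ≤ b → b ∈ A)
    (h : IsNodeStar k B (insert r A) σ) (hs : s ∈ σ) (hrs : rev r ≤ s) (hBA : insert r A ⊆ B) :
    IsNodeStar k A A (shiftStar σ s p) := by
  have hS := shiftStar_subset_Sk hrp hp h.isStar h.subset hs hrs
  have hmax : σ.encard ≤ max (deltaEMax U k) 3 →
      (shiftStar σ s p).encard ≤ max (deltaEMax U k) 3 := (encard_shiftStar_le hs p).trans
  cases h with
  | void _ hσS hstar hv hc =>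
    exact .void _ hS (hstar.shift hs p) (fun P hP hsub =>
      hv P hP (mem_and_subset_of_shiftStar_subset hpk hσS hs hP hsub).2) (hmax hc)
  | eff P _ hP hB hσ hc =>
    by_cases hpP : p ∈ P
    · have h1 := hσ.shift hP hpP hrp hp hs hrs
      -- The shifted star has at most `deltaE k P` elements and is efficient for `P`, so it is again
      -- optimal.
      exact .eff P _ hP (fun a ha => hB a (hBA (.inr ha))) h1
        (le_antisymm ((encard_shiftStar_le hs p).trans hc.le) (iInf₂_le _ h1))
    · refine .void _ hS (hσ.2.1.shift hs p) (fun Q hQ hsub => ?_)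
        (hmax (hc.le.trans (le_max_of_le_left (deltaE_le_deltaEMax hP))))
      obtain ⟨h1, h2⟩ := mem_and_subset_of_shiftStar_subset hpk (hσ.1.trans hP.subset) hs hQ hsub
      have hQP : Q ≠ P := fun h => hpP (h ▸ h1)
      obtain ⟨x, hx, hxQ⟩ := hσ.2.2.2 Q hQ hQP
      exact hQ.rev_notMem (h2 hx) hxQ
  | leaf a haS ha =>
    obtain rfl : s = a := hs
    have h1 : shiftStar {s} s p = {s ⊔ p} := by simp [shiftStar]
    rw [h1] at hS ⊢
    have hS' : s ⊔ p ∈ Sk U k := hS rfl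
    rcases ha with rfl | ha
    · refine isNodeStar_singleton_of_cosmall hS' ?_
      exact ((rev_le_rev_iff _ _).2 le_sup_left).trans (hrs.trans le_sup_left)
    · exact .leaf _ hS' (hA s ha _ hS' le_sup_left)

end Shift

/-! ### The induction on the partial orientation `A` -/

section Existence

variable {U : Type*} [SubmodularUniverse U] {k : ℕ} {A E : Set U} {p r s : U}

/-- Some tree over the node stars relative to `A` efficiently distinguishes all regular profiles
that avoid `A`. -/
def HasEffTree (k : ℕ) (A : Set U) : Prop :=
  ∃ E, TreeOver {σ | IsNodeStar k A A σ} E ∧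
    ∀ P Q, IsRegularProfile (Sk U k) P → IsRegularProfile (Sk U k) Q →
      (∀ a ∈ A, a ∉ P) → (∀ a ∈ A, a ∉ Q) → P ≠ Q → ∃ e ∈ E, EffDistinguishes e P Q

theorem IsNodeStar.mem_or_rev_mem {B σ P : Set U} (hP : IsRegularProfile (Sk U k) P)
    (hσ : IsNodeStar k B A σ) : ∀ t ∈ σ, t ∈ P ∨ rev t ∈ P :=
  fun t ht => hP.1.1.2.2 t (hσ.subset ht)

theorem IsNodeStar.isEffStarFor {B σ P : Set U} (hP : IsRegularProfile (Sk U k) P)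
    (hA : ∀ a ∈ A, a ∉ P) (hσ : IsNodeStar k B A σ) (h : σ ⊆ P) :
    (∀ b ∈ B, b ∉ P) ∧ IsEffStarFor k P σ ∧ σ.encard = deltaE k P := by
  cases hσ with
  | void _ _ _ hv => exact absurd h (hv P hP)
  | leaf a _ ha => exact absurd (h rfl) (hA a ha)
  | eff P' _ hP' hB hσ' hc =>
    obtain rfl : P = P' := by
      by_contra hne
      obtain ⟨x, hx, hxP⟩ := hσ'.2.2.2 P hP hne
      exact hP.rev_notMem (h hx) hxP
    exact ⟨hB, hσ', hc⟩

/-- Either the leaf `r` is dispensable, or the tree is rerooted at it and shifted so that the root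
edge `rev r` becomes `p`. Replacing a distinguisher `e` by `e ⊔ p` does not raise its order, so
efficiency survives. -/
theorem HasEffTree.branch (hA : ∀ a ∈ A, ∀ b ∈ Sk U k, a ≤ b → b ∈ A) (hr : r ∈ Sk U k)
    (hpk : p ∈ Sk U k) (hrp : rev r ≤ p) (hp : ∀ x, rev r ≤ x → x ≤ p → order p ≤ order x)
    (h : HasEffTree k (insert r A)) :
    HasEffTree k A ∨ ∃ E, Branch {σ | IsNodeStar k A A σ} p E ∧
      ∀ P Q, IsRegularProfile (Sk U k) P → IsRegularProfile (Sk U k) Q →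
        (∀ a ∈ A, a ∉ P) → (∀ a ∈ A, a ∉ Q) → P ≠ Q → p ∈ P → p ∈ Q →
        ∃ e ∈ E, EffDistinguishes e P Q := by
  obtain ⟨E, hT, hE⟩ := h
  have hsub : {σ | IsNodeStar k (insert r A) (insert r A) σ} ⊆
      insert {r} {σ | IsNodeStar k (insert r A) A σ} := by
    intro σ hσ
    cases hσ with
    | void _ h1 h2 h3 h4 => exact .inr (.void _ h1 h2 h3 h4)
    | eff P _ h1 h2 h3 h4 => exact .inr (.eff P _ h1 h2 h3 h4)
    | leaf a h1 h2 => exact h2.elim (fun h => .inl (by rw [h])) (fun h => .inr (.leaf a h1 h))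
  have hsup : insert {r} {σ | IsNodeStar k (insert r A) A σ} ⊆
      {σ | IsNodeStar k (insert r A) (insert r A) σ} := by
    rintro σ (rfl | hσ)
    · exact .leaf r hr (Set.mem_insert _ _)
    · exact IsNodeStar.mono le_rfl (Set.subset_insert _ _) hσ
  rcases (hT.mono hsub).reroot with hT' | ⟨E', hB, hcov⟩
  · refine .inl ⟨E, hT'.mono fun σ hσ => IsNodeStar.mono (Set.subset_insert _ _) le_rfl hσ, ?_⟩
    -- Without the leaf `r`, every regular profile avoiding `A` contains a node star, necessarily
    -- its own efficient star; those stars belong only to profiles that avoid `r` too.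
    have key : ∀ P, IsRegularProfile (Sk U k) P → (∀ a ∈ A, a ∉ P) →
        ∀ a ∈ insert r A, a ∉ P := by
      intro P hP hPA
      obtain ⟨σ, hσ, hσP⟩ := hT'.exists_subset (P := P) fun σ hσ => IsNodeStar.mem_or_rev_mem hP hσ
      exact (IsNodeStar.isEffStarFor hP hPA hσ hσP).1
    exact fun P Q hP hQ hPA hQA => hE P Q hP hQ (key P hP hPA) (key Q hQ hQA)
  · right
    have hB' := hB.mono hsup
    obtain ⟨D, hD, hDE⟩ := hB'.shift (k := k) (p := p) (F' := {σ | IsNodeStar k A A σ})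
      (fun σ hσ => IsNodeStar.isStar hσ) (fun σ hσ => IsNodeStar.subset hσ) hrp hp
      (fun σ hσ s hs hrs => IsNodeStar.shift hpk hrp hp hA hσ hs hrs le_rfl) le_rfl
    rw [sup_eq_right.2 hrp] at hD
    refine ⟨D, hD, fun P Q hP hQ hPA hQA hPQ hpP hpQ => ?_⟩
    have key : ∀ P, IsRegularProfile (Sk U k) P → (∀ a ∈ A, a ∉ P) → p ∈ P →
        ∀ a ∈ insert r A, a ∉ P := by
      rintro P hP hPA hpP a (rfl | ha)
      · intro haP
        exact hP.rev_notMem haP (hP.mem_of_le hpP (rev_mem_Sk hr) hrp)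
      · exact hPA a ha
    have main : ∀ P Q, IsRegularProfile (Sk U k) P → IsRegularProfile (Sk U k) Q → p ∈ P →
        p ∈ Q → ∀ e ∈ E', EffDistinguishes e P Q → e ∈ P → rev e ∈ Q →
        ∃ e ∈ D, EffDistinguishes e P Q := by
      intro P Q hP hQ hpP hpQ e he heff heP heQ
      have hre : rev r ≤ e := hB'.le (fun σ hσ => IsNodeStar.isStar hσ) e he
      have ho := order_sup_le_of_le hrp hp hre
      have hk : e ⊔ p ∈ Sk U k := lt_of_le_of_lt ho (hP.subset heP)
      refine ⟨e ⊔ p, hDE e he P hP hpP heP, .inl ⟨hP.sup_mem heP hpP hk, ?_⟩, ?_⟩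
      · exact hQ.mem_of_le heQ (rev_mem_Sk hk) ((rev_le_rev_iff _ _).2 le_sup_left)
      · exact fun ⟨x, hx, hd⟩ => heff.2 ⟨x, hx.trans_le ho, hd⟩
    have main' : ∀ e ∈ E', EffDistinguishes e P Q → ∃ e ∈ D, EffDistinguishes e P Q := by
      intro e he heff
      rcases heff.1 with ⟨h1, h2⟩ | ⟨h1, h2⟩
      · exact main P Q hP hQ hpP hpQ e he heff h1 h2
      · obtain ⟨d, hd, hd'⟩ := main Q P hQ hP hpQ hpP e he heff.symm h2 h1
        exact ⟨d, hd, hd'.symm⟩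
    obtain ⟨e, he, heff⟩ := hE P Q hP hQ (key P hP hPA hpP) (key Q hQ hQA hpQ) hPQ
    rcases hcov e he with h | h
    · exact main' e h heff
    · exact main' _ h heff.rev

theorem isRegularProfile_diff (hA : ∀ a ∈ A, ∀ b ∈ Sk U k, a ≤ b → b ∈ A)
    (h1 : ∀ s ∈ Sk U k, s ∈ A ∨ rev s ∈ A) (h2 : ∀ s ∈ A, rev s ∉ A)
    (hv : ∀ σ, σ ⊆ Sk U k \ A → ¬ IsNodeStar k A A σ) :
    IsRegularProfile (Sk U k) (Sk U k \ A) := by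
  have hreg : Regular (Sk U k \ A) := fun s hs hc =>
    hv {s} (by simpa using hs) (isNodeStar_singleton_of_cosmall hs.1 hc)
  refine ⟨⟨⟨Set.sdiff_subset, ?_, ?_⟩, ?_, ?_⟩, hreg⟩
  · intro s hs
    rw [Set.encard_le_one_iff]
    have h3 : ¬ (s ∉ A ∧ rev s ∉ A) := fun h => (h1 s hs).elim h.1 h.2
    rintro a b ⟨ha, rfl | rfl⟩ ⟨hb, rfl | rfl⟩
    · rfl
    · exact absurd ⟨ha.2, hb.2⟩ h3
    · exact absurd ⟨hb.2, ha.2⟩ h3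
    · rfl
  · intro s hs
    rcases h1 s hs with h | h
    · exact .inr ⟨rev_mem_Sk hs, h2 s h⟩
    · exact .inl ⟨hs, fun h' => h2 s h' h⟩
  · rintro ⟨r, hr, s, hs, hle, -⟩
    exact hs.2 (hA _ ((h1 r hr.1).resolve_left hr.2) s hs.1 hle)
  · have key : ∀ r ∈ Sk U k \ A, ∀ s ∈ Sk U k \ A, order (r ⊓ rev s) ≤ order r →
        rev r ⊓ rev s ∉ Sk U k \ A := by
      intro r hr s hs ho hq
      have hk : r ⊓ rev s ∈ Sk U k := lt_of_le_of_lt ho hr.1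
      have hrA : r ⊓ rev s ∉ A := fun h => hr.2 (hA _ h r hr.1 inf_le_left)
      -- This star is void: a profile containing `s` and `rev r ⊓ rev s` cannot contain `r`, so it
      -- contains `rev r ⊔ s`, the inverse of the first element.
      refine hv {r ⊓ rev s, s, rev r ⊓ rev s} ?_ (.void _ ?_ ?_ ?_ ?_)
      · rintro x (rfl | rfl | rfl)
        exacts [⟨hk, hrA⟩, hs, hq]
      · rintro x (rfl | rfl | rfl)
        exacts [hk, hs.1, hq.1]
      · have e1 : r ⊓ rev s ≤ rev s := inf_le_right
        have e2 : rev r ⊓ rev s ≤ rev s := inf_le_right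
        have e3 : r ⊓ rev s ≤ rev (rev r ⊓ rev s) := by
          rw [rev_inf, rev_rev]; exact inf_le_left.trans le_sup_left
        rintro x (rfl | rfl | rfl) y (rfl | rfl | rfl) hxy
        · exact absurd rfl hxy
        · exact e1
        · exact e3
        · exact le_rev_iff.1 e1
        · exact absurd rfl hxy
        · exact le_rev_iff.1 e2
        · exact le_rev_iff.1 e3
        · exact e2
        · exact absurd rfl hxy
      · intro P hP hsub
        have m1 : r ⊓ rev s ∈ P := hsub (by simp)
        have m2 : s ∈ P := hsub (by simp)
        have m3 : rev r ⊓ rev s ∈ P := hsub (by simp)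
        by_cases hrP : r ∈ P
        · exact hP.1.2.2 r hrP s m2 m3
        · have h3 : rev (r ⊓ rev s) = rev r ⊔ s := by rw [rev_inf, rev_rev]
          refine hP.rev_notMem m1 ?_
          rw [h3]
          refine hP.sup_mem (hP.rev_mem hr.1 hrP) m2 ?_
          rw [← h3]
          exact rev_mem_Sk hk
      · refine le_max_of_le_right ?_
        exact Set.encard_insert_le _ _ |>.trans (by
          have := Set.encard_insert_le {rev r ⊓ rev s} s
          rw [Set.encard_singleton] at this
          calc _ ≤ (1 + 1 : ℕ∞) + 1 := add_le_add_left this 1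
            _ = 3 := by norm_num)
    intro r hr s hs
    rcases order_inf_rev_le_or r s with h | h
    · exact key r hr s hs h
    · rw [inf_comm]
      exact key s hs r hr h

theorem hasEffTree_of_forall_mem_or [Finite U] (hAS : A ⊆ Sk U k)
    (hA : ∀ a ∈ A, ∀ b ∈ Sk U k, a ≤ b → b ∈ A) (h1 : ∀ s ∈ Sk U k, s ∈ A ∨ rev s ∈ A) :
    HasEffTree k A := by
  have hleaf : ∀ a ∈ A, Branch {σ | IsNodeStar k A A σ} a {a} := fun a ha =>
    .leaf (.leaf a (hAS ha) ha)
  have hdist : ∀ P Q, IsRegularProfile (Sk U k) P → IsRegularProfile (Sk U k) Q →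
      (∀ a ∈ A, a ∉ P) → (∀ a ∈ A, a ∉ Q) → ¬ P ≠ Q := by
    intro P Q hP hQ hPA hQA hPQ
    obtain ⟨s, hs, hs'⟩ := hP.exists_of_ne hQ hPQ.symm
    exact (h1 s (hP.subset hs)).elim (fun h => hPA s h hs) (fun h => hQA _ h hs')
  suffices h : ∃ E, TreeOver {σ | IsNodeStar k A A σ} E by
    obtain ⟨E, hE⟩ := h
    exact ⟨E, hE, fun P Q hP hQ hPA hQA hPQ => absurd hPQ (hdist P Q hP hQ hPA hQA)⟩
  by_cases h2 : ∀ s ∈ A, rev s ∉ A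
  · have : ∃ σ, σ ⊆ Sk U k \ A ∧ IsNodeStar k A A σ := by
      by_contra! hv
      have hP := isRegularProfile_diff hA h1 h2 hv
      obtain ⟨σ, hσ, hc⟩ := exists_isEffStarFor_encard_eq hP
      exact hv σ hσ.1 (.eff _ σ hP (fun b hb h => h.2 hb) hσ hc)
    obtain ⟨σ, hsub, hσ⟩ := this
    exact ⟨_, σ, hσ, fun t => {rev t}, fun t ht =>
      hleaf _ ((h1 t (hsub ht).1).resolve_left (hsub ht).2), rfl⟩
  · push Not at h2
    obtain ⟨s, hs, hs'⟩ := h2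
    obtain ⟨E, hE, -⟩ := (hleaf s hs).glue (hleaf _ hs')
    exact ⟨E, hE⟩

theorem hasEffTree [Finite U] (A : Set U) (hAS : A ⊆ Sk U k)
    (hA : ∀ a ∈ A, ∀ b ∈ Sk U k, a ≤ b → b ∈ A) : HasEffTree k A := by
  induction A using WellFoundedGT.induction with
  | ind A ih =>
    by_cases h1 : ∀ s ∈ Sk U k, s ∈ A ∨ rev s ∈ A
    · exact hasEffTree_of_forall_mem_or hAS hA h1
    push Not at h1
    obtain ⟨t, ⟨htk, htA, htA'⟩, hmin⟩ :=
      (Set.toFinite {s | s ∈ Sk U k ∧ s ∉ A ∧ rev s ∉ A}).exists_minimalFor order _ h1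
    have hmin' : ∀ x ∈ Sk U k, x ∉ A → rev x ∉ A → order t ≤ order x := fun x h1 h2 h3 =>
      (le_total (order t) (order x)).elim id (hmin ⟨h1, h2, h3⟩)
    have hmax : ∀ s ∈ Sk U k, s ∉ A → ∃ r ∈ Sk U k, s ≤ r ∧ r ∉ A ∧ HasEffTree k (insert r A) := by
      intro s hs hsA
      obtain ⟨r, hsr, hr⟩ := (Set.toFinite (Sk U k \ A)).exists_le_maximal ⟨hs, hsA⟩
      refine ⟨r, hr.1.1, hsr, hr.1.2, ih _ (Set.ssubset_insert hr.1.2) ?_ ?_⟩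
      · exact Set.insert_subset hr.1.1 hAS
      -- Maximality of `r` outside `A` keeps `insert r A` up-closed.
      · rintro a (rfl | ha) b hb hab
        · by_cases hbA : b ∈ A
          · exact .inr hbA
          · exact .inl (le_antisymm (hr.2 ⟨hb, hbA⟩ hab) hab)
        · exact .inr (hA a ha b hb hab)
    obtain ⟨r₁, hr₁k, htr₁, hr₁A, hT₁⟩ := hmax t htk htA
    obtain ⟨r₂, hr₂k, htr₂, hr₂A, hT₂⟩ := hmax (rev t) (rev_mem_Sk htk) htA'
    -- Such an `x` in `Sk U k` is undecided: up-closedness of `A` would otherwise put `r₁` or `r₂`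
    -- into `A`.
    have hlink : ∀ x, x ≤ r₁ → rev x ≤ r₂ → order t ≤ order x := by
      intro x hx hx'
      by_cases hxk : x ∈ Sk U k
      · exact hmin' x hxk (fun h => hr₁A (hA _ h _ hr₁k hx))
          (fun h => hr₂A (hA _ h _ hr₂k hx'))
      · exact (Nat.le_of_lt htk).trans (not_lt.1 hxk)
    rcases hT₁.branch (p := rev t) hA hr₁k (rev_mem_Sk htk) ((rev_le_rev_iff _ _).2 htr₁)
      (fun x hx hx' => by
        rw [order_rev, ← order_rev x]
        exact hlink _ (rev_le_iff.1 hx) (by rw [rev_rev]; exact hx'.trans htr₂)) with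
      h | ⟨E₁, hB₁, hE₁⟩
    · exact h
    rcases hT₂.branch (p := t) hA hr₂k htk (rev_le_iff.1 htr₂)
      (fun x hx hx' => hlink x (hx'.trans htr₁) (rev_le_iff.1 hx)) with h | ⟨E₂, hB₂, hE₂⟩
    · exact h
    obtain ⟨E, hE, hcov⟩ := hB₂.glue hB₁
    refine ⟨E, hE, fun P Q hP hQ hPA hQA hPQ => ?_⟩
    have hcov' : ∀ e ∈ E₂ ∪ E₁, EffDistinguishes e P Q → ∃ e ∈ E, EffDistinguishes e P Q :=
      fun e he h => (hcov e he).elim (fun he => ⟨e, he, h⟩) (fun he => ⟨_, he, h.rev⟩)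
    -- Separations of lower order than `t` are decided by `A`, hence oriented alike by all profiles
    -- avoiding `A`.
    have hno : ∀ x, order x < order t → ¬ Distinguishes x P Q := by
      intro x hx hd
      have hxk : x ∈ Sk U k := lt_trans hx htk
      refine absurd (hmin' x hxk ?_ ?_) (not_le.2 hx)
      · intro h; exact hd.elim (fun h' => hPA _ h h'.1) (fun h' => hQA _ h h'.2)
      · intro h; exact hd.elim (fun h' => hQA _ h h'.2) (fun h' => hPA _ h h'.1)
    have heff : Distinguishes t P Q → ∃ e ∈ E, EffDistinguishes e P Q := fun hd =>
      hcov' t (.inl hB₂.self_mem) ⟨hd, fun ⟨x, hx, hx'⟩ => hno x hx hx'⟩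
    by_cases htP : t ∈ P <;> by_cases htQ : t ∈ Q
    · obtain ⟨e, he, h⟩ := hE₂ P Q hP hQ hPA hQA hPQ htP htQ
      exact hcov' e (.inl he) h
    · exact heff (.inl ⟨htP, hQ.rev_mem htk htQ⟩)
    · exact heff (.inr ⟨hP.rev_mem htk htP, htQ⟩)
    · obtain ⟨e, he, h⟩ := hE₁ P Q hP hQ hPA hQA hPQ (hP.rev_mem htk htP) (hQ.rev_mem htk htQ)
      exact hcov' e (.inr he) h

end Existence

/-! ### From inductive trees to graph-theoretic trees -/

section Trees

theorem isTree_sum_sup_edge {V W : Type*} [Finite V] [Finite W] {G : SimpleGraph V}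
    {H : SimpleGraph W} (hG : G.IsTree) (hH : H.IsTree) (v : V) (w : W) :
    (G.sum H ⊔ SimpleGraph.edge (.inl v) (.inr w)).IsTree := by
  have hc := SimpleGraph.Connected.sum_sup_edge (v := v) (w := w) hG.connected hH.connected
  rw [SimpleGraph.isTree_iff_connected_and_card] at hG hH ⊢
  refine ⟨hc, le_antisymm ?_ hc.card_vert_le_card_edgeSet_add_one⟩
  have h1 : Nat.card (G.sum H).edgeSet = Nat.card G.edgeSet + Nat.card H.edgeSet := by
    rw [Nat.card_congr SimpleGraph.edgeSetSumEquiv, Nat.card_sum]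
  have h2 : (G.sum H ⊔ SimpleGraph.edge (.inl v) (.inr w)).edgeSet ⊆
      insert s(.inl v, .inr w) (G.sum H).edgeSet := by
    rw [SimpleGraph.edgeSet_sup]
    refine Set.union_subset (Set.subset_insert _ _) fun e he => .inl ?_
    simp only [SimpleGraph.edge, SimpleGraph.edgeSet_fromEdgeSet] at he
    exact he.1
  have h3 := Set.ncard_le_ncard h2
  have h4 := Set.ncard_insert_le s(.inl v, .inr w) (G.sum H).edgeSet
  rw [Nat.card_sum]
  simp only [Nat.card_coe_set_eq] at *
  omega

variable {U : Type*} [SeparationUniverse U]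

/-- An irredundant `S`-tree whose labelling is a function of pairs of nodes. -/
structure LabelledTree (S : Set U) where
  V : Type
  finite : Finite V
  graph : SimpleGraph V
  isTree : graph.IsTree
  lab : V → V → U
  lab_mem : ∀ a b, graph.Adj a b → lab a b ∈ S
  lab_symm : ∀ a b, graph.Adj a b → lab b a = rev (lab a b)
  lab_inj : ∀ a b c, graph.Adj a c → graph.Adj b c → lab a c = lab b c → a = b

variable {S : Set U} {F : Set (Set U)} {σ τ E D : Set U} {s u : U}

/-- The set of labels of the edges at `v`, oriented towards `v`. -/
def LabelledTree.star (T : LabelledTree S) (v : T.V) : Set U :=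
  {x | ∃ a, T.graph.Adj a v ∧ T.lab a v = x}

/-- There is a labelled tree with a root carrying the star `σ`, whose other nodes carry stars in
`F`, and all elements of `E` are labels of it. -/
def HasRootedTree (S : Set U) (F : Set (Set U)) (σ E : Set U) : Prop :=
  ∃ (T : LabelledTree S) (v : T.V), T.star v = σ ∧ (∀ w, w ≠ v → T.star w ∈ F) ∧
    ∀ e ∈ E, ∃ a b, T.graph.Adj a b ∧ T.lab a b = e

theorem HasRootedTree.empty [Nonempty U] : HasRootedTree S F ∅ ∅ := by
  have u : U := Classical.arbitrary U
  refine ⟨⟨Unit, inferInstance, ⊥, .of_subsingleton, fun _ _ => u, ?_, ?_, ?_⟩, (), ?_, ?_, ?_⟩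
  · exact fun _ _ h => h.elim
  · exact fun _ _ h => h.elim
  · exact fun _ _ _ h => h.elim
  · exact Set.eq_empty_iff_forall_notMem.2 fun _ ⟨_, h, _⟩ => h
  · exact fun w hw => absurd rfl hw
  · exact fun _ h => h.elim

/-- The tree obtained from two disjoint labelled trees by joining a node `w` of the second to a
node `v` of the first by an edge labelled `u` towards `v`. -/
def LabelledTree.join (T₁ T₂ : LabelledTree S) (v : T₁.V) (w : T₂.V) (u : U) (hu : u ∈ S)
    (hu' : rev u ∈ S) (hv : u ∉ T₁.star v) (hw : rev u ∉ T₂.star w) : LabelledTree S where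
  V := T₁.V ⊕ T₂.V
  finite := have := T₁.finite; have := T₂.finite; inferInstance
  graph := T₁.graph.sum T₂.graph ⊔ SimpleGraph.edge (.inl v) (.inr w)
  isTree := have := T₁.finite; have := T₂.finite; isTree_sum_sup_edge T₁.isTree T₂.isTree v w
  lab
    | .inl a, .inl b => T₁.lab a b
    | .inr a, .inr b => T₂.lab a b
    | .inr _, .inl _ => u
    | .inl _, .inr _ => rev u
  lab_mem := by
    rintro (a | a) (b | b) h
    · exact T₁.lab_mem a b (by simpa [SimpleGraph.edge_adj] using h)
    · exact hu'
    · exact hu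
    · exact T₂.lab_mem a b (by simpa [SimpleGraph.edge_adj] using h)
  lab_symm := by
    rintro (a | a) (b | b) h
    · exact T₁.lab_symm a b (by simpa [SimpleGraph.edge_adj] using h)
    · exact (rev_rev u).symm
    · rfl
    · exact T₂.lab_symm a b (by simpa [SimpleGraph.edge_adj] using h)
  lab_inj := by
    rintro (a | a) (b | b) (c | c) h₁ h₂ h <;>
      simp only [SimpleGraph.sup_adj, SimpleGraph.edge_adj, Sum.inl.injEq, Sum.inr.injEq, reduceCtorEq, and_false, false_and,
        or_false, false_or, SimpleGraph.sum_adj, ne_eq, not_false_eq_true, and_true] at h₁ h₂ h ⊢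
    · exact T₁.lab_inj a b c h₁ h₂ h
    · exact h₁.1.trans h₂.1.symm
    · obtain ⟨rfl, rfl⟩ := h₂
      exact hv ⟨a, h₁, h⟩
    · obtain ⟨rfl, rfl⟩ := h₁
      exact hw ⟨b, h₂, h.symm⟩
    · obtain ⟨rfl, rfl⟩ := h₁
      exact hv ⟨b, h₂, h.symm⟩
    · obtain ⟨rfl, rfl⟩ := h₂
      exact hw ⟨a, h₁, h⟩
    · exact h₁.1.trans h₂.1.symm
    · exact T₂.lab_inj a b c h₁ h₂ h

theorem HasRootedTree.join (h₁ : HasRootedTree S F σ E) (h₂ : HasRootedTree S F τ D)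
    (hu : u ∈ S) (hu' : rev u ∈ S) (hσ : u ∉ σ) (hτ : rev u ∉ τ) (hF : insert (rev u) τ ∈ F) :
    HasRootedTree S F (insert u σ) (insert (rev u) (E ∪ D)) := by
  obtain ⟨T₁, v, rfl, hF₁, hE⟩ := h₁
  obtain ⟨T₂, w, rfl, hF₂, hD⟩ := h₂
  let T := T₁.join T₂ v w u hu hu' hσ hτ
  have ha1 : ∀ a b, T.graph.Adj (.inl a) (.inl b) ↔ T₁.graph.Adj a b := fun a b => by
    simp [T, LabelledTree.join, SimpleGraph.edge_adj]
  have ha2 : ∀ a b, T.graph.Adj (.inr a) (.inr b) ↔ T₂.graph.Adj a b := fun a b => by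
    simp [T, LabelledTree.join, SimpleGraph.edge_adj]
  have ha3 : ∀ a b, T.graph.Adj (.inl a) (.inr b) ↔ a = v ∧ b = w := fun a b => by
    simp [T, LabelledTree.join, SimpleGraph.edge_adj]
  have hs1 : ∀ x, x ≠ v → T.star (.inl x) = T₁.star x := by
    intro x hx
    ext y
    constructor
    · rintro ⟨a | a, h, rfl⟩
      · exact ⟨a, (ha1 a x).1 h, rfl⟩
      · exact absurd ((ha3 x a).1 h.symm).1 hx
    · rintro ⟨a, h, rfl⟩
      exact ⟨.inl a, (ha1 a x).2 h, rfl⟩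
  have hs2 : ∀ x, x ≠ w → T.star (.inr x) = T₂.star x := by
    intro x hx
    ext y
    constructor
    · rintro ⟨a | a, h, rfl⟩
      · exact absurd ((ha3 a x).1 h).2 hx
      · exact ⟨a, (ha2 a x).1 h, rfl⟩
    · rintro ⟨a, h, rfl⟩
      exact ⟨.inr a, (ha2 a x).2 h, rfl⟩
  have hs3 : T.star (.inl v) = insert u (T₁.star v) := by
    ext y
    constructor
    · rintro ⟨a | a, h, rfl⟩
      · exact .inr ⟨a, (ha1 a v).1 h, rfl⟩
      · exact .inl rfl
    · rintro (rfl | ⟨a, h, rfl⟩)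
      · exact ⟨.inr w, ((ha3 v w).2 ⟨rfl, rfl⟩).symm, rfl⟩
      · exact ⟨.inl a, (ha1 a v).2 h, rfl⟩
  have hs4 : T.star (.inr w) = insert (rev u) (T₂.star w) := by
    ext y
    constructor
    · rintro ⟨a | a, h, rfl⟩
      · exact .inl rfl
      · exact .inr ⟨a, (ha2 a w).1 h, rfl⟩
    · rintro (rfl | ⟨a, h, rfl⟩)
      · exact ⟨.inl v, (ha3 v w).2 ⟨rfl, rfl⟩, rfl⟩
      · exact ⟨.inr a, (ha2 a w).2 h, rfl⟩
  refine ⟨T, .inl v, hs3, ?_, ?_⟩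
  · rintro (x | x) hx
    · have hx' : x ≠ v := fun h => hx (h ▸ rfl)
      rw [hs1 x hx']
      exact hF₁ x hx'
    · by_cases hxw : x = w
      · rw [hxw, hs4]
        exact hF
      · rw [hs2 x hxw]
        exact hF₂ x hxw
  · rintro e (rfl | he | he)
    · exact ⟨.inl v, .inr w, (ha3 v w).2 ⟨rfl, rfl⟩, rfl⟩
    · obtain ⟨a, b, h, rfl⟩ := hE e he
      exact ⟨.inl a, .inl b, (ha1 a b).2 h, rfl⟩
    · obtain ⟨a, b, h, rfl⟩ := hD e he
      exact ⟨.inr a, .inr b, (ha2 a b).2 h, rfl⟩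

/-- The children are joined to the root one at a time. As `σ` is a set, the new label is never
present already, which is what irredundancy at the root requires. The edge to the parent is left out
of each child's star and restored by the join. -/
theorem HasRootedTree.of_children [Finite U] [Nonempty U] (hS : ∀ s ∈ S, rev s ∈ S) (hσ : σ ⊆ S)
    {D : U → Set U}
    (h : ∀ t ∈ σ, ∃ τ ∈ F, rev t ∈ τ ∧ HasRootedTree S F (τ \ {rev t}) (D t \ {rev t})) :
    HasRootedTree S F σ (⋃ t ∈ σ, D t) := by
  induction σ, Set.toFinite σ using Set.Finite.induction_on with
  | empty => simpa using HasRootedTree.empty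
  | @insert u σ hu _ ih =>
    obtain ⟨τ, hτ, huτ, hT⟩ := h u (Set.mem_insert _ _)
    have h1 := ih (fun t ht => hσ (.inr ht)) (fun t ht => h t (.inr ht))
    have h2 := h1.join hT (hσ (Set.mem_insert _ _)) (hS _ (hσ (Set.mem_insert _ _))) hu
      (fun h => h.2 rfl) (by rwa [Set.insert_sdiff_singleton, Set.insert_eq_of_mem huτ])
    obtain ⟨T, v, h3, h4, h5⟩ := h2
    refine ⟨T, v, h3, h4, fun e he => h5 e ?_⟩
    rw [Set.biUnion_insert] at he
    rcases he with he | he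
    · by_cases heu : e = rev u
      · exact .inl heu
      · exact .inr (.inr ⟨he, heu⟩)
    · exact .inr (.inl he)

theorem Branch.hasRootedTree [Finite U] [Nonempty U] (hS : ∀ s ∈ S, rev s ∈ S) (hF : ∀ σ ∈ F, σ ⊆ S)
    (h : Branch F s E) : ∃ σ ∈ F, s ∈ σ ∧ HasRootedTree S F (σ \ {s}) (E \ {s}) := by
  induction h with
  | mk σ s E hσ hs h ih =>
    refine ⟨σ, hσ, hs, ?_⟩
    obtain ⟨T, v, h3, h4, h5⟩ := HasRootedTree.of_children (F := F) (D := E) hS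
      (Set.sdiff_subset.trans (hF σ hσ)) (fun t ht => ih t ht.1 ht.2)
    exact ⟨T, v, h3, h4, fun e he => h5 e (he.1.resolve_left he.2)⟩

theorem TreeOver.exists_labelledTree [Finite U] [Nonempty U] (hS : ∀ s ∈ S, rev s ∈ S)
    (hF : ∀ σ ∈ F, σ ⊆ S) (h : TreeOver F E) :
    ∃ T : LabelledTree S, (∀ v, T.star v ∈ F) ∧
      ∀ e ∈ E, ∃ a b, T.graph.Adj a b ∧ T.lab a b = e := by
  obtain ⟨σ, hσ, D, hD, rfl⟩ := h
  obtain ⟨T, v, h3, h4, h5⟩ := HasRootedTree.of_children (F := F) (D := D) hS (hF σ hσ)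
    (fun t ht => (hD t ht).hasRootedTree hS hF)
  refine ⟨T, fun w => ?_, h5⟩
  by_cases hw : w = v
  · rw [hw, h3]; exact hσ
  · exact h4 w hw

/-- The `S`-tree given by a labelled tree. -/
def LabelledTree.toSTree (T : LabelledTree S) : STree S where
  V := T.V
  finite := T.finite
  graph := T.graph
  isTree := T.isTree
  label e := T.lab e.fst e.snd
  label_mem e := T.lab_mem _ _ e.adj
  label_symm e := T.lab_symm _ _ e.adj

theorem LabelledTree.irredundant_toSTree (T : LabelledTree S) : T.toSTree.Irredundant := by
  intro e f hef hne h
  obtain ⟨⟨a, c⟩, hac⟩ := e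
  obtain ⟨⟨b, d⟩, hbd⟩ := f
  obtain rfl : c = d := hef
  exact hne (T.lab_inj a b c hac hbd h)

end Trees

/-! ### Order-respecting labels and the nodes of profiles -/

namespace LabelledTree

section Order

variable {U : Type*} [SeparationUniverse U] {S : Set U}

/-- Consecutive edges of a path have comparable labels by the star property at their common node,
since irredundancy makes the two labels towards that node distinct. -/
theorem lab_le_of_mem_darts {T : LabelledTree S} (hT : ∀ v, IsStar (T.star v)) {u v : T.V}
    (p : T.graph.Walk u v) : ∀ {x : T.V} (h : T.graph.Adj x u), (SimpleGraph.Walk.cons h p).IsPath →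
      ∀ d ∈ (SimpleGraph.Walk.cons h p).darts, T.lab x u ≤ T.lab d.fst d.snd := by
  induction p with
  | nil =>
    intro x h _ d hd
    obtain rfl : d = ⟨(x, _), h⟩ := by simpa using hd
    exact le_rfl
  | @cons u w v h' p ih =>
    intro x h hp d hd
    rw [SimpleGraph.Walk.darts_cons, List.mem_cons] at hd
    rcases hd with rfl | hd
    · exact le_rfl
    · rw [SimpleGraph.Walk.cons_isPath_iff] at hp
      refine le_trans ?_ (ih h' hp.1 d hd)
      have hxw : x ≠ w := fun hxw => hp.2 (by simp [hxw])
      have hne : T.lab x u ≠ T.lab w u := fun he => hxw (T.lab_inj x w u h h'.symm he)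
      rw [T.lab_symm w u h'.symm]
      exact hT u _ ⟨x, h, rfl⟩ _ ⟨w, h'.symm, rfl⟩ hne

theorem lab_le_of_isPath {T : LabelledTree S} (hT : ∀ v, IsStar (T.star v)) {a b c d : T.V}
    (hab : T.graph.Adj a b) (hcd : T.graph.Adj c d) (p : T.graph.Walk a d) (hp : p.IsPath)
    (hb : b ∈ p.support) (hc : c ∈ p.support) : T.lab a b ≤ T.lab c d := by
  have hb' := T.isTree.isAcyclic.eq_snd_of_adj_start hp hab hb
  have hc' := T.isTree.isAcyclic.eq_penultimate_of_adj_end hp hcd.symm hc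
  have hnil : ¬ p.Nil := by
    intro h
    rw [SimpleGraph.Walk.nil_iff_support_eq.1 h, List.mem_singleton] at hb
    exact hab.ne hb.symm
  have hlast := SimpleGraph.Walk.lastDart_mem_darts hnil
  cases p with
  | nil => exact absurd .nil hnil
  | cons h q =>
    rw [SimpleGraph.Walk.snd_cons] at hb'
    subst hb'
    have := lab_le_of_mem_darts hT q h hp _ hlast
    rwa [hc']

theorem orderRespecting_toSTree {T : LabelledTree S} (hT : ∀ v, IsStar (T.star v)) :
    T.toSTree.OrderRespecting :=
  fun e f ⟨p, hp, hb, hc⟩ => lab_le_of_isPath hT e.adj f.adj p hp hb hc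

theorem encard_neighborSet (T : LabelledTree S) (v : T.V) :
    (T.graph.neighborSet v).encard = (T.star v).encard := by
  have h1 : T.star v = (fun a => T.lab a v) '' T.graph.neighborSet v := by
    ext x
    constructor
    · rintro ⟨a, h, rfl⟩
      exact ⟨a, h.symm, rfl⟩
    · rintro ⟨a, h, rfl⟩
      exact ⟨a, h.symm, rfl⟩
  rw [h1, Set.InjOn.encard_image]
  exact fun a ha b hb h => T.lab_inj a b v ha.symm hb.symm h

theorem isSink_iff {T : LabelledTree S} {P : Set U} {v : T.V} :
    T.toSTree.IsSink P v ↔ T.star v ⊆ P := by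
  constructor
  · rintro h _ ⟨a, ha, rfl⟩
    exact h ⟨(a, v), ha⟩ rfl
  · rintro h ⟨⟨a, b⟩, hab⟩ rfl
    exact h ⟨a, hab, rfl⟩

end Order

section Node

variable {U : Type*} [SubmodularUniverse U] {k : ℕ} {P : Set U}

/-- Without a sink, each node would have an incident edge that `P` directs away from it. Distinct
nodes get distinct edges, but a tree has fewer edges than nodes. -/
theorem exists_star_subset (T : LabelledTree (Sk U k)) (hP : IsRegularProfile (Sk U k) P) :
    ∃ v, T.star v ⊆ P := by
  have := T.finite
  by_contra! hno
  have h1 : ∀ v, ∃ d : T.graph.Dart, d.snd = v ∧ T.lab d.fst d.snd ∉ P := by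
    intro v
    obtain ⟨_, ⟨a, ha, rfl⟩, h⟩ := Set.not_subset.1 (hno v)
    exact ⟨⟨(a, v), ha⟩, rfl, h⟩
  choose f hf hfP using h1
  have hinj : Function.Injective fun v => (⟨(f v).edge, (f v).edge_mem⟩ : T.graph.edgeSet) := by
    intro v w hvw
    rcases SimpleGraph.dart_edge_eq_iff _ _ |>.1 (Subtype.ext_iff.1 hvw) with h | h
    · rw [← hf v, ← hf w, h]
    · exfalso
      have h2 := hfP v
      rw [h] at h2
      refine h2 ?_
      change T.lab (f w).snd (f w).fst ∈ P
      rw [T.lab_symm _ _ (f w).adj]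
      exact hP.rev_mem (T.lab_mem _ _ (f w).adj) (hfP w)
  have h2 : Nat.card T.V ≤ Nat.card T.graph.edgeSet := Nat.card_le_card_of_injective _ hinj
  have h3 := (SimpleGraph.isTree_iff_connected_and_card.1 T.isTree).2
  omega

/-- On a path between two sinks, the last edge is oriented forwards by `P`, hence so is the first by
consistency; but the first must point back to its sink. -/
theorem eq_of_star_subset {T : LabelledTree (Sk U k)} (hT : ∀ v, IsStar (T.star v))
    (hP : IsRegularProfile (Sk U k) P) {v w : T.V} (hv : T.star v ⊆ P) (hw : T.star w ⊆ P) :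
    w = v := by
  by_contra hne
  obtain ⟨p, hp, -⟩ := T.isTree.existsUnique_path v w
  have hnil : ¬ p.Nil := SimpleGraph.Walk.not_nil_of_ne (Ne.symm hne)
  have hlast := SimpleGraph.Walk.lastDart_mem_darts hnil
  cases p with
  | nil => exact hne rfl
  | @cons _ x _ h q =>
    have h1 := lab_le_of_mem_darts hT q h hp _ hlast
    have h2 : T.lab x v ∈ P := hv ⟨x, h.symm, rfl⟩
    have h3 := hw ⟨_, (SimpleGraph.Walk.lastDart _ hnil).adj, rfl⟩
    refine hP.rev_notMem h2 ?_
    rw [← T.lab_symm _ _ h.symm]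
    exact hP.mem_of_le h3 (T.lab_mem _ _ h) h1

end Node

end LabelledTree

/-! ### Assembling the theorem -/

theorem exists_labelledTree {U : Type*} [SubmodularUniverse U] [Finite U] [Nonempty U] (k : ℕ) :
    ∃ T : LabelledTree (Sk U k), (∀ v, IsNodeStar k ∅ ∅ (T.star v)) ∧
      ∀ P Q, IsRegularProfile (Sk U k) P → IsRegularProfile (Sk U k) Q → P ≠ Q →
        ∃ a b, T.graph.Adj a b ∧ EffDistinguishes (T.lab a b) P Q := by
  obtain ⟨E, hE, heff⟩ := hasEffTree (U := U) (k := k) ∅ (Set.empty_subset _)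
    (fun a ha => ha.elim)
  obtain ⟨T, hT, hTE⟩ := hE.exists_labelledTree (S := Sk U k) (fun s hs => rev_mem_Sk hs)
    (fun σ hσ => IsNodeStar.subset hσ)
  refine ⟨T, hT, fun P Q hP hQ hPQ => ?_⟩
  obtain ⟨e, he, h⟩ := heff P Q hP hQ (fun a ha => ha.elim) (fun a ha => ha.elim) hPQ
  obtain ⟨a, b, hab, rfl⟩ := hTE e he
  exact ⟨a, b, hab, h⟩

theorem IsNodeStar.encard_le {U : Type*} [SubmodularUniverse U] {k : ℕ} {B σ : Set U}
    (h : IsNodeStar k B ∅ σ) : σ.encard ≤ max (deltaEMax U k) 3 := by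
  cases h with
  | void _ _ _ _ hc => exact hc
  | eff P _ hP _ _ hc => exact hc.le.trans (le_max_of_le_left (deltaE_le_deltaEMax hP))
  | leaf a _ ha => exact ha.elim

end SepSys

open SepSys in
-- An empty `U` is treated apart because a labelled tree assigns a value to every pair of nodes,
-- even for a single node. The one-node tree suffices.
theorem mainTheorem6_of_isEmpty {U : Type*} [SubmodularUniverse U] [IsEmpty U] (k : ℕ) :
    ∃ T : SepSys.STree (SepSys.Sk U k),
      T.IsEfficientTreeOfTangles ∧ T.OrderRespecting ∧
      (∀ P : Set U, SepSys.IsRegularProfile (SepSys.Sk U k) P →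
        ∃ v : T.V, T.IsNodeOf P v ∧ T.degree v = SepSys.deltaE k P) ∧
      ∀ v : T.V, T.degree v ≤ max (SepSys.deltaEMax U k) 3 := by
  let T : STree (Sk U k) := ⟨Unit, inferInstance, ⊥, .of_subsingleton, fun d => d.adj.elim,
    fun d => d.adj.elim, fun d => d.adj.elim⟩
  have hdeg : ∀ v, T.degree v = 0 := fun v => by
    rw [STree.degree, Set.encard_eq_zero]
    exact Set.eq_empty_iff_forall_notMem.2 fun _ h => h.elim
  have hT : ∀ d : T.graph.Dart, False := fun d => isEmptyElim (T.label d)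
  have hne : ∀ P Q : Set U, P = Q := fun P Q => Set.ext fun x => isEmptyElim x
  refine ⟨T, ⟨⟨fun d => (hT d).elim, fun P Q _ _ h => absurd (hne P Q) h⟩,
    fun P Q _ _ h => absurd (hne P Q) h⟩, fun d => (hT d).elim, fun P hP => ?_, fun v => ?_⟩
  · refine ⟨(), ⟨fun d => (hT d).elim, fun _ _ => rfl⟩, ?_⟩
    rw [hdeg]
    obtain ⟨σ, hσ, hc⟩ := exists_isEffStarFor_encard_eq hP
    rw [← hc, hne σ ∅, Set.encard_empty]
  · rw [hdeg]
    exact zero_le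

theorem mainTheorem6 {U : Type*} [SubmodularUniverse U] [Finite U] (k : ℕ) :
    ∃ T : SepSys.STree (SepSys.Sk U k),
      T.IsEfficientTreeOfTangles ∧ T.OrderRespecting ∧
      (∀ P : Set U, SepSys.IsRegularProfile (SepSys.Sk U k) P →
        ∃ v : T.V, T.IsNodeOf P v ∧ T.degree v = SepSys.deltaE k P) ∧
      ∀ v : T.V, T.degree v ≤ max (SepSys.deltaEMax U k) 3 := by
  rcases isEmpty_or_nonempty U with hU | hU
  · exact mainTheorem6_of_isEmpty k
  obtain ⟨T, hT, heff⟩ := SepSys.exists_labelledTree (U := U) k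
  have hstar := fun v => (hT v).isStar
  have heff' : ∀ P Q, SepSys.IsRegularProfile (SepSys.Sk U k) P →
      SepSys.IsRegularProfile (SepSys.Sk U k) Q → P ≠ Q →
      ∃ e : T.toSTree.graph.Dart, SepSys.EffDistinguishes (T.toSTree.label e) P Q :=
    fun P Q hP hQ hPQ => by
      obtain ⟨a, b, hab, h⟩ := heff P Q hP hQ hPQ
      exact ⟨⟨(a, b), hab⟩, h⟩
  refine ⟨T.toSTree, ⟨⟨T.irredundant_toSTree, fun P Q hP hQ hPQ => ?_⟩, heff'⟩,
    SepSys.LabelledTree.orderRespecting_toSTree hstar, fun P hP => ?_, fun v => ?_⟩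
  · obtain ⟨e, he⟩ := heff' P Q hP hQ hPQ
    exact ⟨e, he.1⟩
  · obtain ⟨v, hv⟩ := T.exists_star_subset hP
    refine ⟨v, ⟨SepSys.LabelledTree.isSink_iff.2 hv, fun w hw => ?_⟩, ?_⟩
    · exact SepSys.LabelledTree.eq_of_star_subset hstar hP hv (SepSys.LabelledTree.isSink_iff.1 hw)
    · exact (T.encard_neighborSet v).trans
        (SepSys.IsNodeStar.isEffStarFor hP (fun a ha => ha.elim) (hT v) hv).2.2
  · exact (T.encard_neighborSet v).le.trans (hT v).encard_le
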